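/- Conventions. All graphs are finite and simple. $S(x)$ denotes the subgraph generated by the neighbours of a vertex $x$. The one-point graph is contractible, and inductively a graph is contractible if it has a vertex $x$ such that both $S(x)$ and the graph generated by the vertices different from $x$ are contractible. The empty graph is the $(-1)$-sphere; for $n\ge 0$ an $n$-sphere is a graph in which every unit sphere $S(x)$ is an $(n-1)$-sphere and in which there is a vertex whose removal leaves a contractible graph. A (geometric) $d$-graph is a graph in which every unit sphere $S(x)$ is a $(d-1)$-sphere; the empty graph is allowed. For a real function $f$ on the vertex set of $G$, the level surface $\{f=c\}$ is the graph whose vertices are the complete subgraphs (simplices) of $G$ containing vertices with $f<c$ and vertices with $f>c$, two different simplices being adjacent if one contains the other. A function $g$ on the vertices of $G$ is extended to $\{f=c\}$ by assigning to a simplex $s$ the average $\frac{1}{|s|}\sum_{v\in s} g(v)$. A function is strongly injective if its values at the different vertices are linearly independent over $\mathbb{Q}$. Given functions $f_1,\dots,f_k$ on the vertex set of $G$ and real numbers $c_1,\dots,c_k$, put $\overline f_1=f_1$; extend $f_2,\dots,f_k$ to the graph $\{f_1=c_1\}$, let $\overline f_2$ be the extension of $f_2$, extend the extensions of $f_3,\dots,f_k$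 further to the level surface $\{\overline f_2=c_2\}$ of the graph $\{f_1=c_1\}$, and so on; the graph obtained after $k$ steps is denoted $\{f_1=c_1,\dots,f_k=c_k\}$. The sequence $c_1,\dots,c_k$ is compatible with $f_1,\dots,f_k$ if, for every $j$, the function $\overline f_j$ on $\{f_1=c_1,\dots,f_{j-1}=c_{j-1}\}$ does not take the value $c_j$ and is not constant, i.e. does not take exactly one value (so the function on the empty graph does not count as constant). Theorem (Discrete Sard for an ordered set). Let $G$ be a $d$-graph, let $0\le k\le d$, and let $f_1,\dots,f_k$ be strongly injective functions on the vertex set of $G$. Then only finitely many values have to be excluded in each coordinate: there are finite sets $C_1,\dots,C_k\subset\mathbb{R}$ such that for all $(c_1,\dots,c_k)\in\mathbb{R}^k$ with $c_j\notin C_j$ for $j=1,\dots,k$, the sequence $c_1,\dots,c_k$ is compatible with $f_1,\dots,f_k$ and $\{f_1=c_1,\dots,f_k=c_k\}$ is a (possibly empty) geometric $(d-k)$-graph. -/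

import Mathlib

noncomputable section

universe u

namespace DiscreteSard

/-- The unit sphere `S(x)`: the subgraph generated by the neighbours of `x`. -/
abbrev unitSphere {V : Type u} (G : SimpleGraph V) (x : V) : SimpleGraph (G.neighborSet x) :=
  G.induce (G.neighborSet x)

/-- The graph generated by all vertices different from `x`. -/
abbrev removeVertex {V : Type u} (G : SimpleGraph V) (x : V) :
    SimpleGraph (({x}ᶜ : Set V) : Type u) :=
  G.induce ({x}ᶜ : Set V)

/-- Contractible graphs: the one point graph is contractible, and `G` is contractible if it has a
vertex `x` such that both `S(x)` and `G` without `x` are contractible. (Such a graph is finite.) -/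
inductive IsContractible : {V : Type u} → SimpleGraph V → Prop
  | point {V : Type u} (G : SimpleGraph V) (hV : Nat.card V = 1) : IsContractible G
  | step {V : Type u} (G : SimpleGraph V) (x : V) (hS : IsContractible (unitSphere G x))
      (hR : IsContractible (removeVertex G x)) : IsContractible G

/-- `IsPredSphere n G` says that `G` is an `(n - 1)`-sphere, the index being shifted by one so that
it is a natural number: the `(-1)`-sphere is the empty graph, and an `n`-sphere is a finite simple
graph in which every unit sphere is an `(n - 1)`-sphere and from which one can remove a single
vertex so that the rest is contractible. -/
def IsPredSphere : (n : ℕ) → {V : Type u} → SimpleGraph V → Prop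
  | 0, V, _ => IsEmpty V
  | n + 1, V, G => Finite V ∧ (∀ x : V, IsPredSphere n (unitSphere G x)) ∧
      ∃ x : V, IsContractible (removeVertex G x)

/-- A `d`-graph: a finite simple graph in which every unit sphere is a `(d - 1)`-sphere.
The empty graph is a `d`-graph. -/
def IsDGraph (d : ℕ) {V : Type u} (G : SimpleGraph V) : Prop :=
  Finite V ∧ ∀ x : V, IsPredSphere d (unitSphere G x)

/-- The simplices (vertex sets of complete subgraphs) of `G` on which `f - c` changes sign. -/
def LevelVertex {V : Type u} (G : SimpleGraph V) (f : V → ℝ) (c : ℝ) : Type u :=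
  {s : Finset V // G.IsClique (s : Set V) ∧ (∃ v ∈ s, f v - c < 0) ∧ (∃ v ∈ s, 0 < f v - c)}

/-- The level surface `{f = c}`: two different simplices are adjacent if one contains the other. -/
def levelSurface {V : Type u} (G : SimpleGraph V) (f : V → ℝ) (c : ℝ) :
    SimpleGraph (LevelVertex G f c) where
  Adj s t := s.1 ⊂ t.1 ∨ t.1 ⊂ s.1
  symm := ⟨fun _ _ h => h.symm⟩
  loopless := ⟨fun s h => h.elim (ssubset_irrefl s.1) (ssubset_irrefl s.1)⟩

/-- Extension of a function `g` on the vertices of `G` to `{f = c}`, by averaging over the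
vertices of each simplex. -/
def extend {V : Type u} (G : SimpleGraph V) (f : V → ℝ) (c : ℝ) (g : V → ℝ) :
    LevelVertex G f c → ℝ :=
  fun s => (∑ v ∈ s.1, g v) / (s.1.card : ℝ)

/-- The graph `{f₁ = c₁, …, f_k = c_k}` (with its vertex type): pass to `{f₁ = c₁}`, extend the
remaining functions to it, and continue there. -/
def iteratedLevel : (k : ℕ) → {V : Type u} → SimpleGraph V → (Fin k → V → ℝ) → (Fin k → ℝ) →
    (W : Type u) × SimpleGraph W
  | 0, V, G, _, _ => ⟨V, G⟩
  | k + 1, _, G, f, c => iteratedLevel k (levelSurface G (f 0) (c 0))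
      (fun j => extend G (f 0) (c 0) (f j.succ)) (fun j => c j.succ)

/-- A function is constant if it takes exactly one value (the function on the empty set takes
none, so it is not constant). -/
def IsConstant {V : Type u} (f : V → ℝ) : Prop :=
  ∃ a : ℝ, Set.range f = {a}

/-- The sequence `c₁, …, c_k` is compatible with `f₁, …, f_k`: each extended function, on the level
surface of the previous ones, does not take the prescribed value and is not constant. -/
def Compatible : (k : ℕ) → {V : Type u} → SimpleGraph V → (Fin k → V → ℝ) → (Fin k → ℝ) → Prop
  | 0, _, _, _, _ => True
  | k + 1, _, G, f, c => c 0 ∉ Set.range (f 0) ∧ ¬ IsConstant (f 0) ∧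
      Compatible k (levelSurface G (f 0) (c 0))
        (fun j => extend G (f 0) (c 0) (f j.succ)) (fun j => c j.succ)

/-- A function is strongly injective if its values at the vertices are rationally independent. -/
def StronglyInjective {V : Type u} (f : V → ℝ) : Prop :=
  LinearIndependent ℚ f

end DiscreteSard

end

/-!
The level surface of a function `f` that avoids the value `c` on a `d`-graph `G` is a
`(d - 1)`-graph. Its vertices are the simplices of `G` on which `f - c` changes sign, and the unit
sphere of such a simplex `s` is the join of two spheres. The simplices below `s` are the proper
subsets of `s` on which `f - c` still changes sign; they refine the boundary of a product of two
simplices and form a sphere of dimension `|s| - 3` (`predSphereOn_mixedProperSubsets`). On every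
simplex above `s` the function changes sign, so these simplices form the barycentric refinement of
the link of `s`, which is a sphere of dimension `d - |s|` (`PredSphereOn.link`,
`PredSphereOn.simplicesOver`). Joins of spheres are spheres (`PredSphereOn.join`), and the total
dimension is `d - 2`. This gives `IsDGraph.signSurface`.

Refinements and level surfaces are sets of elements of a partial order, with comparability
as adjacency. Contractibility is derived from closure operators: a finite set with such an operator
is contractible as soon as the set of closed elements is (`ContractibleOn.of_closure`).

Along the iteration strong injectivity is replaced by independence of the values on each simplex.
This property passes to level surfaces, whose simplices are chains of simplices
(`IndependentOnSimplices.signExtend`), and it excludes constant functions on graphs of positive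
dimension, where each vertex has a neighbour.

Finally, a level surface depends on `c` only through the signs of `f - c` at the vertices. There are
finitely many sign patterns, and the exceptional values of the later coordinates are the union, over
all patterns, of those obtained by induction (`exists_finite_exceptional_sets`).
-/

open Set

namespace DiscreteSard

universe u

/-! ### Induced subgraphs of an ambient graph -/

/-- The subgraph of `K` generated by the vertex set `S` is contractible. -/
def ContractibleOn {P : Type u} (K : SimpleGraph P) (S : Set P) : Prop :=
  IsContractible (K.induce S)

/-- The subgraph of `K` generated by the vertex set `S` is an `(n - 1)`-sphere. -/
def PredSphereOn (n : ℕ) {P : Type u} (K : SimpleGraph P) (S : Set P) : Prop :=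
  IsPredSphere n (K.induce S)

/-- A graph isomorphism restricts to subgraphs generated by corresponding vertex sets. -/
def isoInduce {V W : Type u} {G : SimpleGraph V} {H : SimpleGraph W} (e : G ≃g H)
    (A : Set V) (B : Set W) (h : ∀ v, v ∈ A ↔ e v ∈ B) : G.induce A ≃g H.induce B where
  toEquiv := e.toEquiv.subtypeEquiv h
  map_rel_iff' := by
    intro a b
    exact e.map_rel_iff

/-- Generating a subgraph twice is the same as generating it once. -/
def isoInduceInduce {V : Type u} (G : SimpleGraph V) (S : Set V) (T : Set S) (R : Set V)
    (h : ∀ v, v ∈ R ↔ ∃ hv : v ∈ S, (⟨v, hv⟩ : S) ∈ T) : (G.induce S).induce T ≃g G.induce R where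
  toFun v := ⟨v.1.1, (h _).2 ⟨v.1.2, v.2⟩⟩
  invFun v := ⟨⟨v.1, ((h _).1 v.2).1⟩, ((h _).1 v.2).2⟩
  left_inv _ := rfl
  right_inv _ := rfl
  map_rel_iff' := Iff.rfl

/-- A graph isomorphism restricts to unit spheres. -/
def isoUnitSphere {V W : Type u} {G : SimpleGraph V} {H : SimpleGraph W} (e : G ≃g H) (x : V) :
    unitSphere G x ≃g unitSphere H (e x) :=
  isoInduce e _ _ fun _ => e.map_adj_iff.symm

/-- A graph isomorphism restricts to the graphs with corresponding vertices removed. -/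
def isoRemoveVertex {V W : Type u} {G : SimpleGraph V} {H : SimpleGraph W} (e : G ≃g H) (x : V) :
    removeVertex G x ≃g removeVertex H (e x) :=
  isoInduce e _ _ fun v => by simp

/-- A unit sphere of an induced subgraph, as an induced subgraph of the ambient graph. -/
def isoUnitSphereInduce {P : Type u} (K : SimpleGraph P) (S : Set P) (x : S) :
    unitSphere (K.induce S) x ≃g K.induce (S ∩ K.neighborSet x) :=
  isoInduceInduce K S _ _ fun v => by simp

/-- An induced subgraph with a vertex removed, as an induced subgraph of the ambient graph. -/
def isoRemoveVertexInduce {P : Type u} (K : SimpleGraph P) (S : Set P) (x : S) :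
    removeVertex (K.induce S) x ≃g K.induce (S \ {x.1}) :=
  isoInduceInduce K S _ _ fun v => by
    simp [Subtype.ext_iff]

theorem IsContractible.of_iso {V W : Type u} {G : SimpleGraph V} {H : SimpleGraph W}
    (hG : IsContractible G) (e : G ≃g H) : IsContractible H := by
  induction hG generalizing W with
  | point G hV => exact .point H ((Nat.card_congr e.toEquiv).symm.trans hV)
  | step G x _ _ ihS ihR =>
    exact .step H (e x) (ihS (isoUnitSphere e x)) (ihR (isoRemoveVertex e x))

theorem IsPredSphere.of_iso {n : ℕ} {V W : Type u} {G : SimpleGraph V} {H : SimpleGraph W}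
    (hG : IsPredSphere n G) (e : G ≃g H) : IsPredSphere n H := by
  induction n generalizing V W with
  | zero =>
    have : IsEmpty V := hG
    exact e.symm.toEquiv.isEmpty
  | succ n ih =>
    obtain ⟨hf, hS, x, hx⟩ := hG
    refine ⟨Finite.of_equiv V e.toEquiv, fun y => ?_, e x, hx.of_iso (isoRemoveVertex e x)⟩
    exact ih (hS (e.symm y)) ((isoUnitSphere e.symm y).symm)

section AmbientGraph

variable {P : Type u} {K : SimpleGraph P}

theorem ContractibleOn.step {S : Set P} {x : P} (hx : x ∈ S)
    (hS : ContractibleOn K (S ∩ K.neighborSet x)) (hR : ContractibleOn K (S \ {x})) :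
    ContractibleOn K S :=
  IsContractible.step _ ⟨x, hx⟩ (IsContractible.of_iso hS (isoUnitSphereInduce K S ⟨x, hx⟩).symm)
    (IsContractible.of_iso hR (isoRemoveVertexInduce K S ⟨x, hx⟩).symm)

theorem contractibleOn_singleton (x : P) : ContractibleOn K {x} :=
  .point _ (by simp)

/-- Induction over the construction of a contractible subgraph of a fixed ambient graph. -/
theorem ContractibleOn.induction {motive : Set P → Prop} (point : ∀ x, motive {x})
    (step : ∀ (S : Set P) (x : P), x ∈ S → motive (S ∩ K.neighborSet x) → motive (S \ {x}) →
      motive S) {S : Set P} (hS : ContractibleOn K S) : motive S := by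
  have key : ∀ {V : Type u} {H : SimpleGraph V}, IsContractible H → ∀ S : Set P,
      (H ≃g K.induce S) → motive S := by
    intro V H hH
    induction hH with
    | point H hV =>
      intro S e
      obtain ⟨x, rfl⟩ := Set.ncard_eq_one.1 ((Nat.card_congr e.toEquiv).symm.trans hV)
      exact point x
    | step H x _ _ ihS ihR =>
      intro S e
      exact step S (e x) (e x).2 (ihS _ ((isoUnitSphere e x).trans (isoUnitSphereInduce K S (e x))))
        (ihR _ ((isoRemoveVertex e x).trans (isoRemoveVertexInduce K S (e x))))
  exact key hS S (SimpleGraph.Iso.refl)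

theorem predSphereOn_zero {S : Set P} : PredSphereOn 0 K S ↔ S = ∅ :=
  Set.isEmpty_coe_sort

theorem predSphereOn_succ {n : ℕ} {S : Set P} : PredSphereOn (n + 1) K S ↔
    S.Finite ∧ (∀ x ∈ S, PredSphereOn n K (S ∩ K.neighborSet x)) ∧
      ∃ x ∈ S, ContractibleOn K (S \ {x}) := by
  constructor
  · rintro ⟨hf, hS, x, hx⟩
    exact ⟨hf, fun y hy => (hS ⟨y, hy⟩).of_iso (isoUnitSphereInduce K S ⟨y, hy⟩),
      x, x.2, hx.of_iso (isoRemoveVertexInduce K S x)⟩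
  · rintro ⟨hf, hS, x, hxS, hx⟩
    exact ⟨hf, fun y => (hS y y.2).of_iso (isoUnitSphereInduce K S y).symm,
      ⟨x, hxS⟩, IsContractible.of_iso hx (isoRemoveVertexInduce K S ⟨x, hxS⟩).symm⟩

theorem PredSphereOn.finite {n : ℕ} {S : Set P} (h : PredSphereOn n K S) : S.Finite := by
  cases n with
  | zero => rw [predSphereOn_zero.1 h]; exact Set.finite_empty
  | succ n => exact (predSphereOn_succ.1 h).1

/-! ### Cones and joins -/

theorem contractibleOn_of_cone {S : Set P} (hf : S.Finite) {m : P} (hm : m ∈ S)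
    (h : ∀ x ∈ S, x ≠ m → K.Adj x m) : ContractibleOn K S := by
  induction hn : S.ncard using Nat.strong_induction_on generalizing S with
  | _ n ih =>
  by_cases hS : ∃ x ∈ S, x ≠ m
  · obtain ⟨x, hx, hxm⟩ := hS
    have hlt : ∀ T ⊆ S, x ∉ T → T.ncard < n := fun T hT hxT =>
      hn ▸ Set.ncard_lt_ncard ⟨hT, fun h' => hxT (h' hx)⟩ hf
    refine .step hx (ih _ (hlt _ inter_subset_left (by simp)) (hf.subset inter_subset_left)
      ⟨hm, h x hx hxm⟩ (fun y hy => h y hy.1) rfl) (ih _ (hlt _ sdiff_subset (by simp))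
      (hf.subset sdiff_subset) ⟨hm, hxm.symm⟩ (fun y hy => h y hy.1) rfl)
  · push Not at hS
    rw [show S = {m} from Set.eq_singleton_iff_unique_mem.2 ⟨hm, hS⟩]
    exact contractibleOn_singleton m

theorem ContractibleOn.join {A B : Set P} (hA : ContractibleOn K A) (hB : B.Finite)
    (h : ∀ a ∈ A, ∀ b ∈ B, K.Adj a b) : ContractibleOn K (A ∪ B) := by
  refine hA.induction (motive := fun A => (∀ a ∈ A, ∀ b ∈ B, K.Adj a b) →
    ContractibleOn K (A ∪ B)) ?_ ?_ h
  · intro x h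
    refine contractibleOn_of_cone (m := x) ((finite_singleton x).union hB) (by simp) ?_
    rintro y (rfl | hy) hyx
    · exact absurd rfl hyx
    · exact (h x rfl y hy).symm
  · intro A x hx ihS ihR h
    have h1 : (A ∪ B) ∩ K.neighborSet x = A ∩ K.neighborSet x ∪ B := by
      ext y
      have := h x hx y
      simp only [mem_inter_iff, mem_union, SimpleGraph.mem_neighborSet]
      tauto
    have h2 : (A ∪ B) \ {x} = A \ {x} ∪ B := by
      ext y
      have : y ∈ B → y ≠ x := fun hy hyx => (h x hx y hy).ne hyx.symm
      simp only [mem_sdiff, mem_union, mem_singleton_iff]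
      tauto
    exact .step (Or.inl hx) (h1 ▸ ihS fun a ha => h a ha.1) (h2 ▸ ihR fun a ha => h a ha.1)

theorem PredSphereOn.join {n m : ℕ} {A B : Set P} (hA : PredSphereOn n K A)
    (hB : PredSphereOn m K B) (h : ∀ a ∈ A, ∀ b ∈ B, K.Adj a b) :
    PredSphereOn (n + m) K (A ∪ B) := by
  induction hN : n + m generalizing n m A B with
  | zero =>
    obtain ⟨rfl, rfl⟩ : n = 0 ∧ m = 0 := by omega
    rw [predSphereOn_zero] at *
    simp [hA, hB]
  | succ N ih =>
    cases n with
    | zero =>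
      rw [predSphereOn_zero] at hA
      obtain rfl : m = N + 1 := by omega
      simpa [hA] using hB
    | succ n =>
    cases m with
    | zero =>
      rw [predSphereOn_zero] at hB
      obtain rfl : n = N := by omega
      simpa [hB] using hA
    | succ m =>
    obtain ⟨hAf, hAs, x, hx, hxA⟩ := predSphereOn_succ.1 hA
    obtain ⟨hBf, hBs, -⟩ := predSphereOn_succ.1 hB
    refine predSphereOn_succ.2 ⟨hAf.union hBf, ?_, x, Or.inl hx, ?_⟩
    · rintro y (hy | hy)
      · have h1 : (A ∪ B) ∩ K.neighborSet y = A ∩ K.neighborSet y ∪ B := by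
          ext z
          have := h y hy z
          simp only [mem_inter_iff, mem_union, SimpleGraph.mem_neighborSet]
          tauto
        rw [h1]
        exact ih (hAs y hy) hB (fun a ha => h a ha.1) (by omega)
      · have h1 : (A ∪ B) ∩ K.neighborSet y = A ∪ B ∩ K.neighborSet y := by
          ext z
          have := fun hz : z ∈ A => (h z hz y hy).symm
          simp only [mem_inter_iff, mem_union, SimpleGraph.mem_neighborSet]
          tauto
        rw [h1]
        exact ih hA (hBs y hy) (fun a ha b hb => h a ha b hb.1) (by omega)
    · have h2 : (A ∪ B) \ {x} = A \ {x} ∪ B := by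
        ext y
        have : y ∈ B → y ≠ x := fun hy hyx => (h x hx y hy).ne hyx.symm
        simp only [mem_sdiff, mem_union, mem_singleton_iff]
        tauto
      rw [h2]
      exact hxA.join hBf fun a ha => h a ha.1

/-! ### Comparability graphs -/

/-- The comparability graph of a partial order. -/
def comparabilityGraph (P : Type u) [PartialOrder P] : SimpleGraph P where
  Adj a b := a < b ∨ b < a
  symm := ⟨fun _ _ h => h.symm⟩
  loopless := ⟨fun a h => h.elim (lt_irrefl a) (lt_irrefl a)⟩

theorem inter_neighborSet_comparabilityGraph [PartialOrder P] (S : Set P) (x : P) :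
    S ∩ (comparabilityGraph P).neighborSet x = S ∩ Iio x ∪ S ∩ Ioi x := by
  ext y
  simp only [comparabilityGraph, mem_inter_iff, SimpleGraph.mem_neighborSet, mem_union, mem_Iio,
    mem_Ioi]
  tauto

/-- In a comparability graph the unit sphere of `x` is the join of the elements below `x` and the
elements above `x`. -/
theorem PredSphereOn.inter_neighborSet [PartialOrder P] {S : Set P} {x : P} {n m : ℕ}
    (h₁ : PredSphereOn n (comparabilityGraph P) (S ∩ Iio x))
    (h₂ : PredSphereOn m (comparabilityGraph P) (S ∩ Ioi x)) :
    PredSphereOn (n + m) (comparabilityGraph P) (S ∩ (comparabilityGraph P).neighborSet x) := by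
  rw [inter_neighborSet_comparabilityGraph]
  exact h₁.join h₂ fun a ha b hb => Or.inl (lt_trans ha.2 hb.2)

/-- A set with a closure operator is contractible if the set of closed elements is: the other
elements can be removed, a maximal one first, because the unit sphere of a maximal non-closed
element is a cone over its closure. -/
theorem ContractibleOn.of_closure [PartialOrder P] {S : Set P} (hf : S.Finite) (φ : P → P)
    (hφS : ∀ x ∈ S, φ x ∈ S) (hle : ∀ x ∈ S, x ≤ φ x) (hidem : ∀ x ∈ S, φ (φ x) = φ x)
    (hmono : ∀ x ∈ S, ∀ y ∈ S, x ≤ y → φ x ≤ φ y)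
    (h : ContractibleOn (comparabilityGraph P) {x ∈ S | φ x = x}) :
    ContractibleOn (comparabilityGraph P) S := by
  induction hn : S.ncard using Nat.strong_induction_on generalizing S with
  | _ n ih =>
  by_cases hS : {x ∈ S | φ x ≠ x}.Nonempty
  · obtain ⟨x, ⟨hx, hxφ⟩, hmax⟩ := (hf.subset (sep_subset S _)).exists_maximal hS
    have hlt : x < φ x := lt_of_le_of_ne (hle x hx) (Ne.symm hxφ)
    refine .step hx ?_ (ih _ (hn ▸ Set.ncard_sdiff_singleton_lt_of_mem hx hf) (hf.subset sdiff_subset)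
      (fun y hy => ⟨hφS y hy.1, ?_⟩) (fun y hy => hle y hy.1) (fun y hy => hidem y hy.1)
      (fun y hy z hz => hmono y hy.1 z hz.1) ?_ rfl)
    · refine contractibleOn_of_cone (m := φ x) (hf.subset inter_subset_left)
        ⟨hφS x hx, Or.inl hlt⟩ ?_
      rintro y ⟨hy, hxy | hyx⟩ hne
      · have hfix : φ y = y := by
          by_contra hne'
          exact (hmax ⟨hy, hne'⟩ hxy.le).not_gt hxy
        exact Or.inr (lt_of_le_of_ne (hfix ▸ hmono x hx y hy hxy.le) hne.symm)
      · exact Or.inl (lt_trans hyx hlt)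
    · rintro (hyx : φ y = x)
      exact hxφ (hyx ▸ hidem y hy.1)
    · convert h using 1
      ext y
      have : φ y = y → y ≠ x := fun hy hyx => hxφ (hyx ▸ hy)
      simp only [mem_ofPred_eq, mem_sdiff, mem_singleton_iff]
      tauto
  · convert h using 1
    ext y
    have : y ∈ S → φ y = y := fun hy => by
      by_contra hne
      exact hS ⟨y, hy, hne⟩
    simp only [mem_ofPred_eq]
    tauto

theorem ContractibleOn.of_interior [PartialOrder P] {S : Set P} (hf : S.Finite) (φ : P → P)
    (hφS : ∀ x ∈ S, φ x ∈ S) (hle : ∀ x ∈ S, φ x ≤ x) (hidem : ∀ x ∈ S, φ (φ x) = φ x)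
    (hmono : ∀ x ∈ S, ∀ y ∈ S, x ≤ y → φ x ≤ φ y)
    (h : ContractibleOn (comparabilityGraph P) {x ∈ S | φ x = x}) :
    ContractibleOn (comparabilityGraph P) S := by
  have hd : comparabilityGraph Pᵒᵈ = comparabilityGraph P := by
    ext a b
    exact or_comm
  have := ContractibleOn.of_closure (P := Pᵒᵈ) (S := S) hf φ hφS hle hidem
    (fun x hx y hy => hmono y hy x hx) (by rw [hd]; exact h)
  rwa [hd] at this

end AmbientGraph

section FiniteSets

variable {V : Type u}

/-! ### Spheres of finite sets -/

/-- The open interval `(s, t)` of finite sets is the barycentric refinement of the boundary of the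
simplex `t \ s`. -/
theorem predSphereOn_Ioo (n : ℕ) (s t : Finset V) (hst : s ⊆ t) (hn : s.card + (n + 1) = t.card) :
    PredSphereOn n (comparabilityGraph (Finset V)) (Ioo s t) := by
  classical
  induction n using Nat.strong_induction_on generalizing s t with
  | _ n ih =>
  cases n with
  | zero =>
    rw [predSphereOn_zero, Set.eq_empty_iff_forall_notMem]
    rintro u ⟨hu, hut⟩
    have := Finset.card_lt_card hu
    have := Finset.card_lt_card hut
    omega
  | succ n =>
  have hf : (Ioo s t).Finite := Set.finite_Ioo s t
  refine predSphereOn_succ.2 ⟨hf, ?_, ?_⟩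
  · rintro u ⟨hu, hut⟩
    have h1 := Finset.card_lt_card hu
    have h2 := Finset.card_lt_card hut
    have e1 : Ioo s t ∩ Iio u = Ioo s u := by
      ext v
      exact ⟨fun h => ⟨h.1.1, h.2⟩, fun h => ⟨⟨h.1, h.2.trans hut⟩, h.2⟩⟩
    have e2 : Ioo s t ∩ Ioi u = Ioo u t := by
      ext v
      exact ⟨fun h => ⟨h.2, h.1.2⟩, fun h => ⟨⟨hu.trans h.1, h.2⟩, h.1⟩⟩
    have := PredSphereOn.inter_neighborSet (S := Ioo s t) (x := u)
      (e1 ▸ ih (u.card - s.card - 1) (by omega) s u hu.le (by omega))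
      (e2 ▸ ih (t.card - u.card - 1) (by omega) u t hut.le (by omega))
    rwa [show u.card - s.card - 1 + (t.card - u.card - 1) = n by omega] at this
  · obtain ⟨x, hxt, hxs⟩ : ∃ x ∈ t, x ∉ s := by
      by_contra! h
      have := Finset.card_le_card (show t ⊆ s from h)
      omega
    have hsx : s ⊂ insert x s := Finset.ssubset_insert hxs
    -- Away from `t \ {x}`, adding `x` is a closure operator whose smallest value is `s ∪ {x}`.
    have hins : ∀ u ∈ Ioo s t \ {t.erase x}, insert x u ∈ Ioo s t \ {t.erase x} := by
      rintro u ⟨⟨hu, hut⟩, hne⟩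
      refine ⟨⟨lt_of_lt_of_le hu (Finset.subset_insert x u),
        lt_of_le_of_ne (Finset.insert_subset hxt hut.le) ?_⟩, ?_⟩
      · intro he
        by_cases hxu : x ∈ u
        · rw [Finset.insert_eq_of_mem hxu] at he
          exact hut.ne he
        · exact hne (by rw [mem_singleton_iff, ← he, Finset.erase_insert hxu])
      · rintro (he : insert x u = t.erase x)
        exact Finset.notMem_erase x t (he ▸ Finset.mem_insert_self x u)
    refine ⟨t.erase x, ⟨?_, Finset.erase_ssubset hxt⟩, ?_⟩
    · refine lt_of_le_of_ne (Finset.subset_erase.2 ⟨hst, hxs⟩) fun he => ?_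
      have := Finset.card_erase_of_mem hxt
      rw [← he] at this
      omega
    · refine .of_closure (hf.subset sdiff_subset) (insert x) hins
        (fun u _ => Finset.subset_insert x u) (fun u _ => by simp)
        (fun u _ v _ h => Finset.insert_subset_insert x h) ?_
      refine contractibleOn_of_cone (m := insert x s) ((hf.subset sdiff_subset).subset
        (sep_subset _ _)) ⟨⟨⟨hsx, ?_⟩, ?_⟩, by simp⟩ ?_
      · refine lt_of_le_of_ne (Finset.insert_subset hxt hst) fun he => ?_
        have := Finset.card_insert_of_notMem hxs
        rw [he] at this
        omega
      · rintro (he : insert x s = t.erase x)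
        exact Finset.notMem_erase x t (he ▸ Finset.mem_insert_self x s)
      · rintro u ⟨⟨⟨hu, -⟩, -⟩, hxu⟩ hne
        refine Or.inr (lt_of_le_of_ne ?_ hne.symm)
        rw [← hxu]
        exact Finset.insert_subset_insert x hu.le

/-- The proper subsets of `t` that meet both `p` and `q`. If `p` and `q` partition `t` into sets
with `a` and `b` elements, they form the barycentric refinement of the boundary of a product of an
`(a - 1)`-simplex and a `(b - 1)`-simplex. -/
def mixedProperSubsets (p q : V → Prop) (t : Finset V) : Set (Finset V) :=
  {u | u ⊂ t ∧ (∃ v ∈ u, p v) ∧ ∃ v ∈ u, q v}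

theorem finite_mixedProperSubsets (p q : V → Prop) (t : Finset V) :
    (mixedProperSubsets p q t).Finite := by
  classical
  exact (Set.finite_Iio t).subset fun _ h => h.1

theorem mixedProperSubsets_comm (p q : V → Prop) (t : Finset V) :
    mixedProperSubsets p q t = mixedProperSubsets q p t := by
  ext u
  simp only [mixedProperSubsets, mem_ofPred_eq]
  tauto

/-- Removing `t \ {x}` from the mixed proper subsets of `t` leaves a contractible graph: adding `x`,
and then deleting all elements of `p` other than `x`, retracts it onto the sets `{x} ∪ b` with
`b` a nonempty part of `q`, and these have a largest element. -/
theorem contractibleOn_mixedProperSubsets_diff {p q : V → Prop} (hpq : ∀ v, q v ↔ ¬ p v)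
    [DecidableEq V] {t : Finset V} {x y : V} (hxt : x ∈ t) (hx : p x) (hyt : y ∈ t) (hyx : y ≠ x)
    (hy : p y) (hq : ∃ v ∈ t, q v) :
    ContractibleOn (comparabilityGraph (Finset V)) (mixedProperSubsets p q t \ {t.erase x}) := by
  classical
  have hf := (finite_mixedProperSubsets p q t).subset (sdiff_subset (t := {t.erase x}))
  have herase : ∀ u : Finset V, x ∈ u → u ∉ ({t.erase x} : Set (Finset V)) := by
    rintro u hxu (rfl : u = _)
    exact Finset.notMem_erase x t hxu
  refine .of_closure hf (insert x) ?_ (fun u _ => Finset.subset_insert x u) (fun u _ => by simp)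
    (fun u _ v _ h => Finset.insert_subset_insert x h) ?_
  · rintro u ⟨⟨hut, -, v, hvu, hv⟩, hne⟩
    refine ⟨⟨lt_of_le_of_ne (Finset.insert_subset hxt hut.le) fun he => ?_,
      ⟨x, Finset.mem_insert_self x u, hx⟩, v, Finset.mem_insert_of_mem hvu, hv⟩,
      herase _ (Finset.mem_insert_self x u)⟩
    by_cases hxu : x ∈ u
    · rw [Finset.insert_eq_of_mem hxu] at he
      exact hut.ne he
    · exact hne (by rw [mem_singleton_iff, ← he, Finset.erase_insert hxu])
  set ψ : Finset V → Finset V := fun u => u.filter fun v => v = x ∨ q v with hψ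
  have hmem : ∀ {u v}, v ∈ ψ u ↔ v ∈ u ∧ (v = x ∨ q v) := by simp [hψ]
  have hyψ : ∀ u, y ∉ ψ u := fun u h => (hmem.1 h).2.elim hyx fun h' => (hpq y).1 h' hy
  have hψt : ∀ u, u ⊆ t → ψ u ⊂ t := fun u hu =>
    lt_of_le_of_ne ((Finset.filter_subset _ _).trans hu) fun he => hyψ u (he ▸ hyt)
  refine .of_interior (hf.subset (sep_subset _ _)) ψ ?_ (fun u _ => Finset.filter_subset _ _)
    (fun u _ => by simp [hψ, Finset.filter_filter]) (fun u _ v _ h => Finset.filter_subset_filter _ h)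
    ?_
  · rintro u ⟨⟨⟨hut, -, v, hvu, hv⟩, hne⟩, hxu⟩
    have hxu' : x ∈ ψ u := hmem.2 ⟨Finset.insert_eq_self.1 hxu, Or.inl rfl⟩
    exact ⟨⟨⟨hψt u hut.le, ⟨x, hxu', hx⟩, v, hmem.2 ⟨hvu, Or.inr hv⟩, hv⟩, herase _ hxu'⟩,
      Finset.insert_eq_self.2 hxu'⟩
  · obtain ⟨v, hvt, hv⟩ := hq
    have hxt' : x ∈ ψ t := hmem.2 ⟨hxt, Or.inl rfl⟩
    refine contractibleOn_of_cone (m := ψ t) ((hf.subset (sep_subset _ _)).subset (sep_subset _ _))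
      ⟨⟨⟨⟨hψt t subset_rfl, ⟨x, hxt', hx⟩, v, hmem.2 ⟨hvt, Or.inr hv⟩, hv⟩, herase _ hxt'⟩,
        Finset.insert_eq_self.2 hxt'⟩, by simp [hψ, Finset.filter_filter]⟩ ?_
    rintro u ⟨⟨⟨⟨hut, -⟩, -⟩, -⟩, hu⟩ hne
    refine Or.inl (lt_of_le_of_ne ?_ hne)
    rw [← hu]
    exact Finset.filter_subset_filter _ hut.le

theorem predSphereOn_mixedProperSubsets {p q : V → Prop} (hpq : ∀ v, q v ↔ ¬ p v) (n : ℕ)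
    (t : Finset V) (hp : ∃ v ∈ t, p v) (hq : ∃ v ∈ t, q v) (hn : t.card = n + 2) :
    PredSphereOn n (comparabilityGraph (Finset V)) (mixedProperSubsets p q t) := by
  classical
  -- A set meeting both `p` and `q` has at least two elements.
  have htwo : ∀ u : Finset V, (∃ v ∈ u, p v) → (∃ v ∈ u, q v) → 2 ≤ u.card := by
    rintro u ⟨v, hvu, hv⟩ ⟨w, hwu, hw⟩
    exact Finset.one_lt_card.2 ⟨v, hvu, w, hwu, fun h => (hpq w).1 hw (h ▸ hv)⟩
  induction n using Nat.strong_induction_on generalizing t with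
  | _ n ih =>
  cases n with
  | zero =>
    rw [predSphereOn_zero, Set.eq_empty_iff_forall_notMem]
    rintro u ⟨hut, hu, hu'⟩
    have := Finset.card_lt_card hut
    have := htwo u hu hu'
    omega
  | succ n =>
  refine predSphereOn_succ.2 ⟨finite_mixedProperSubsets p q t, ?_, ?_⟩
  · rintro u ⟨hut, hu, hu'⟩
    have h1 := Finset.card_lt_card hut
    have h2 := htwo u hu hu'
    have e1 : mixedProperSubsets p q t ∩ Iio u = mixedProperSubsets p q u := by
      ext v
      exact ⟨fun h => ⟨h.2, h.1.2⟩, fun h => ⟨⟨h.1.trans hut, h.2⟩, h.1⟩⟩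
    have e2 : mixedProperSubsets p q t ∩ Ioi u = Ioo u t := by
      ext v
      refine ⟨fun h => ⟨h.2, h.1.1⟩, fun h => ⟨⟨h.2, ?_, ?_⟩, h.1⟩⟩
      · exact hu.imp fun w hw => ⟨h.1.le hw.1, hw.2⟩
      · exact hu'.imp fun w hw => ⟨h.1.le hw.1, hw.2⟩
    have := PredSphereOn.inter_neighborSet (S := mixedProperSubsets p q t) (x := u)
      (e1 ▸ ih (u.card - 2) (by omega) u hu hu' (by omega))
      (e2 ▸ predSphereOn_Ioo (t.card - u.card - 1) u t hut.le (by omega))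
    rwa [show u.card - 2 + (t.card - u.card - 1) = n by omega] at this
  · obtain ⟨a, hat, ha⟩ := hp
    obtain ⟨b, hbt, hb⟩ := hq
    have hab : b ≠ a := fun h => (hpq b).1 hb (h ▸ ha)
    -- As `t` has a third element `c`, one of `p` and `q` has two elements in `t`.
    obtain ⟨c, hct, hca, hcb⟩ : ∃ c ∈ t, c ≠ a ∧ c ≠ b := by
      by_contra! h
      have : t ⊆ {a, b} := fun c hc => by
        by_cases hca : c = a
        · simp [hca]
        · simp [h c hc hca]
      have := (Finset.card_le_card this).trans Finset.card_le_two
      omega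
    refine ⟨t.erase c, ⟨Finset.erase_ssubset hct, ⟨a, Finset.mem_erase.2 ⟨hca.symm, hat⟩, ha⟩,
      b, Finset.mem_erase.2 ⟨hcb.symm, hbt⟩, hb⟩, ?_⟩
    by_cases hc : p c
    · exact contractibleOn_mixedProperSubsets_diff hpq hct hc hat hca.symm ha ⟨b, hbt, hb⟩
    · rw [mixedProperSubsets_comm]
      exact contractibleOn_mixedProperSubsets_diff (fun v => by simp [hpq]) hct ((hpq c).2 hc) hbt
        hcb.symm hb ⟨a, hat, ha⟩

/-! ### Barycentric refinements -/

/-- The finite sets `s ∪ t` where `t` is the vertex set of a nonempty complete subgraph in `U`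
(`s` being disjoint from `U` in the applications). Their comparability graph is a copy of the
barycentric refinement of the graph generated by `U`. -/
def simplicesOver (G : SimpleGraph V) (U : Set V) (s : Finset V) : Set (Finset V) :=
  {t | s ⊂ t ∧ (∀ v ∈ t, v ∉ s → v ∈ U) ∧ G.IsClique {v | v ∈ t ∧ v ∉ s}}

theorem finite_simplicesOver (G : SimpleGraph V) {U : Set V} (hU : U.Finite) (s : Finset V) :
    (simplicesOver G U s).Finite := by
  classical
  refine (Set.finite_Iic (s ∪ hU.toFinset)).subset fun t ht v hv => ?_
  by_cases hvs : v ∈ s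
  · exact Finset.mem_union_left _ hvs
  · exact Finset.mem_union_right _ (hU.mem_toFinset.2 (ht.2.1 v hv hvs))

variable {G : SimpleGraph V}

theorem insert_mem_simplicesOver [DecidableEq V] {U : Set V} {s : Finset V} {x : V} (hx : x ∈ U)
    (hxs : x ∉ s) : insert x s ∈ simplicesOver G U s := by
  refine ⟨Finset.ssubset_insert hxs, fun v hv hvs => ?_, ?_⟩
  · rwa [(Finset.mem_insert.1 hv).resolve_right hvs]
  · rintro v ⟨hv, hvs⟩ w ⟨hw, hws⟩ hne
    exact absurd (((Finset.mem_insert.1 hv).resolve_right hvs).trans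
      ((Finset.mem_insert.1 hw).resolve_right hws).symm) hne

theorem simplicesOver_inter_Ioi {U : Set V} {s t : Finset V} (ht : t ∈ simplicesOver G U s) :
    simplicesOver G U s ∩ Ioi t =
      simplicesOver G (U ∩ {v | ∀ w ∈ t, w ∉ s → G.Adj w v}) t := by
  ext r
  constructor
  · rintro ⟨⟨hsr, hrU, hr⟩, htr : t < r⟩
    refine ⟨htr, fun v hv hvt => ⟨hrU v hv fun h => hvt (ht.1.le h), fun w hw hws => ?_⟩, ?_⟩
    · exact hr ⟨htr.le hw, hws⟩ ⟨hv, fun h => hvt (ht.1.le h)⟩ fun h => hvt (h ▸ hw)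
    · exact fun v hv w hw hne =>
        hr ⟨hv.1, fun h => hv.2 (ht.1.le h)⟩ ⟨hw.1, fun h => hw.2 (ht.1.le h)⟩ hne
  · rintro ⟨htr, hrU, hr⟩
    refine ⟨⟨ht.1.trans htr, fun v hv hvs => ?_, ?_⟩, htr⟩
    · by_cases hvt : v ∈ t
      · exact ht.2.1 v hvt hvs
      · exact (hrU v hv hvt).1
    · rintro v ⟨hv, hvs⟩ w ⟨hw, hws⟩ hne
      by_cases hvt : v ∈ t <;> by_cases hwt : w ∈ t
      · exact ht.2.2 ⟨hvt, hvs⟩ ⟨hwt, hws⟩ hne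
      · exact (hrU w hw hwt).2 v hvt hvs
      · exact ((hrU v hv hvt).2 w hwt hws).symm
      · exact hr ⟨hv, hvt⟩ ⟨hw, hwt⟩ hne

/-- The elements above the vertex `s ∪ {x}` form the refinement of the unit sphere of `x`, so that
no relabelling of vertices is needed. -/
theorem simplicesOver_inter_neighborSet_insert [DecidableEq V] {U : Set V} {s : Finset V} {x : V}
    (hx : x ∈ U) (hUs : ∀ v ∈ s, v ∉ U) :
    simplicesOver G U s ∩ (comparabilityGraph (Finset V)).neighborSet (insert x s) =
      simplicesOver G (U ∩ G.neighborSet x) (insert x s) := by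
  have hxs : x ∉ s := fun h => hUs x h hx
  have hlow : simplicesOver G U s ∩ Iio (insert x s) = ∅ := by
    rw [Set.eq_empty_iff_forall_notMem]
    rintro t ⟨ht, htx⟩
    have h1 := Finset.card_lt_card ht.1
    have h2 := Finset.card_lt_card htx
    rw [Finset.card_insert_of_notMem hxs] at h2
    omega
  rw [inter_neighborSet_comparabilityGraph, hlow, Set.empty_union,
    simplicesOver_inter_Ioi (insert_mem_simplicesOver hx hxs)]
  congr 2
  ext v
  simp only [mem_ofPred_eq, SimpleGraph.mem_neighborSet, Finset.mem_insert]
  exact ⟨fun h => h x (Or.inl rfl) hxs, fun h w hw hws => hw.resolve_right hws ▸ h⟩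

/-- Deleting `x` from every simplex other than `{x}` retracts the refinement of `U`, with the vertex
`{x}` removed, onto the refinement of `U \ {x}`. -/
theorem contractibleOn_simplicesOver_diff [DecidableEq V] {U : Set V} (hU : U.Finite)
    {s : Finset V} {x : V} (hUs : ∀ v ∈ s, v ∉ U) (hx : x ∈ U)
    (h : ContractibleOn (comparabilityGraph (Finset V)) (simplicesOver G (U \ {x}) s)) :
    ContractibleOn (comparabilityGraph (Finset V)) (simplicesOver G U s \ {insert x s}) := by
  have hxs : x ∉ s := fun h => hUs x h hx
  refine .of_interior ((finite_simplicesOver G hU s).subset sdiff_subset) (fun t => t.erase x) ?_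
    (fun t _ => Finset.erase_subset x t) (fun t _ => Finset.erase_idem)
    (fun t _ r _ htr => Finset.erase_subset_erase x htr) ?_
  · rintro t ⟨⟨hst, htU, ht⟩, hne⟩
    refine ⟨⟨lt_of_le_of_ne (Finset.subset_erase.2 ⟨hst.le, hxs⟩) fun he => ?_,
      fun v hv => htU v (Finset.mem_of_mem_erase hv),
      fun v hv w hw hne => ht ⟨Finset.mem_of_mem_erase hv.1, hv.2⟩
        ⟨Finset.mem_of_mem_erase hw.1, hw.2⟩ hne⟩, ?_⟩
    · by_cases hxt : x ∈ t
      · exact hne (by rw [mem_singleton_iff, he, Finset.insert_erase hxt])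
      · rw [Finset.erase_eq_of_notMem hxt] at he
        exact hst.ne he
    · rintro (he : t.erase x = insert x s)
      exact Finset.notMem_erase x t (he ▸ Finset.mem_insert_self x s)
  · convert h using 1
    ext t
    constructor
    · rintro ⟨⟨⟨hst, htU, ht⟩, -⟩, hxt⟩
      refine ⟨hst, fun v hv hvs => ⟨htU v hv hvs, ?_⟩, ht⟩
      rintro rfl
      exact Finset.erase_eq_self.1 hxt hv
    · rintro ⟨hst, htU, ht⟩
      have hxt : x ∉ t := fun h => (htU x h hxs).2 rfl
      refine ⟨⟨⟨hst, fun v hv hvs => (htU v hv hvs).1, ht⟩, ?_⟩, Finset.erase_eq_of_notMem hxt⟩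
      rintro (rfl : t = _)
      exact hxt (Finset.mem_insert_self x s)

theorem ContractibleOn.simplicesOver {U : Set V} (h : ContractibleOn G U) (hU : U.Finite)
    (s : Finset V) (hUs : ∀ v ∈ s, v ∉ U) :
    ContractibleOn (comparabilityGraph (Finset V)) (simplicesOver G U s) := by
  classical
  refine h.induction (motive := fun U => U.Finite → ∀ s : Finset V, (∀ v ∈ s, v ∉ U) →
    ContractibleOn (comparabilityGraph (Finset V)) (DiscreteSard.simplicesOver G U s)) ?_ ?_ hU s
    hUs
  · intro x _ s hUs
    have hxs : x ∉ s := fun h => hUs x h rfl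
    convert contractibleOn_singleton (K := comparabilityGraph (Finset V)) (insert x s) using 1
    refine Set.eq_singleton_iff_unique_mem.2 ⟨insert_mem_simplicesOver rfl hxs, ?_⟩
    rintro t ⟨hst, htU, -⟩
    have hle : t ⊆ insert x s := fun v hv => by
      by_cases hvs : v ∈ s
      · exact Finset.mem_insert_of_mem hvs
      · exact Finset.mem_insert.2 (Or.inl (htU v hv hvs))
    refine Finset.eq_of_subset_of_card_le hle ?_
    rw [Finset.card_insert_of_notMem hxs]
    exact Finset.card_lt_card hst
  · intro U x hx ihS ihR hU s hUs
    have hxs : x ∉ s := fun h => hUs x h hx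
    refine .step (insert_mem_simplicesOver hx hxs) ?_ (contractibleOn_simplicesOver_diff hU hUs hx
      (ihR (hU.subset sdiff_subset) s fun v hv h => hUs v hv h.1))
    rw [simplicesOver_inter_neighborSet_insert hx hUs]
    refine ihS (hU.subset inter_subset_left) _ fun v hv h => ?_
    obtain rfl | hv := Finset.mem_insert.1 hv
    · exact G.loopless.irrefl _ h.2
    · exact hUs v hv h.1

/-- In a sphere, the link of a simplex is a sphere. -/
theorem PredSphereOn.link {n : ℕ} {U : Set V} (h : PredSphereOn n G U) (s : Set V) (hs : s.Finite)
    (hsU : s ⊆ U) (hc : G.IsClique s) :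
    ∃ m, n = m + s.ncard ∧ PredSphereOn m G (U ∩ {v | ∀ w ∈ s, G.Adj w v}) := by
  induction s, hs using Set.Finite.induction_on generalizing n U with
  | empty => exact ⟨n, by simp, by simpa using h⟩
  | @insert x s hxs hs ih =>
    cases n with
    | zero =>
      rw [predSphereOn_zero] at h
      exact absurd (hsU (mem_insert x s)) (by simp [h])
    | succ n =>
    have hx := (predSphereOn_succ.1 h).2.1 x (hsU (mem_insert x s))
    obtain ⟨m, hm, hl⟩ := ih hx (fun v hv => ⟨hsU (mem_insert_of_mem x hv),
      hc (mem_insert x s) (mem_insert_of_mem x hv) fun h => hxs (h ▸ hv)⟩)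
      (hc.subset (subset_insert x s))
    refine ⟨m, by rw [Set.ncard_insert_of_notMem hxs hs]; omega, ?_⟩
    convert hl using 1
    ext v
    simp only [mem_inter_iff, mem_ofPred_eq, SimpleGraph.mem_neighborSet, forall_mem_insert]
    tauto

/-- The barycentric refinement of a sphere is a sphere. -/
theorem PredSphereOn.simplicesOver {n : ℕ} {U : Set V} (h : PredSphereOn n G U)
    (s : Finset V) (hUs : ∀ v ∈ s, v ∉ U) :
    PredSphereOn n (comparabilityGraph (Finset V)) (simplicesOver G U s) := by
  classical
  induction n using Nat.strong_induction_on generalizing U s with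
  | _ n ih =>
  cases n with
  | zero =>
    rw [predSphereOn_zero] at h
    rw [predSphereOn_zero, Set.eq_empty_iff_forall_notMem]
    rintro t ⟨hst, htU, -⟩
    obtain ⟨v, hv, hvs⟩ := Finset.exists_of_ssubset hst
    simpa [h] using htU v hv hvs
  | succ n =>
  obtain ⟨hU, -, x, hx, hR⟩ := predSphereOn_succ.1 h
  refine predSphereOn_succ.2 ⟨finite_simplicesOver G hU s, ?_, insert x s,
    insert_mem_simplicesOver hx fun h => hUs x h hx, contractibleOn_simplicesOver_diff hU hUs hx
      (hR.simplicesOver (hU.subset sdiff_subset) s fun v hv h => hUs v hv h.1)⟩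
  intro t ht
  have hcard := Finset.card_lt_card ht.1
  obtain ⟨m, hm, hl⟩ := h.link {v | v ∈ t ∧ v ∉ s} (t.finite_toSet.subset fun v hv => hv.1)
    (fun v hv => ht.2.1 v hv.1 hv.2) ht.2.2
  have hnc : ({v | v ∈ t ∧ v ∉ s} : Set V).ncard = t.card - s.card := by
    rw [← Finset.card_sdiff_of_subset ht.1.le, ← Set.ncard_coe_finset]
    congr 1
    ext v
    simp
  have e1 : DiscreteSard.simplicesOver G U s ∩ Iio t = Ioo s t := by
    ext r
    exact ⟨fun h => ⟨h.1.1, h.2⟩, fun h => ⟨⟨h.1, fun v hv => ht.2.1 v (h.2.le hv),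
      fun v hv w hw hne => ht.2.2 ⟨h.2.le hv.1, hv.2⟩ ⟨h.2.le hw.1, hw.2⟩ hne⟩, h.2⟩⟩
  have e2 := simplicesOver_inter_Ioi ht
  have hl' : PredSphereOn m G (U ∩ {v | ∀ w ∈ t, w ∉ s → G.Adj w v}) := by
    convert hl using 3
    simp
  have := PredSphereOn.inter_neighborSet (S := DiscreteSard.simplicesOver G U s) (x := t)
    (e1 ▸ predSphereOn_Ioo (t.card - s.card - 1) s t ht.1.le (by omega))
    (e2 ▸ ih m (by omega) hl' t fun v hv hvU =>
      G.loopless.irrefl _ (hvU.2 v hv fun hvs => hUs v hvs hvU.1))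
  rwa [show t.card - s.card - 1 + m = n by omega] at this

end FiniteSets

/-! ### Level surfaces -/

/-- The vertices of the level surface, for abstract sign conditions `p` (negative) and `q`
(positive). -/
def SignVertex {V : Type u} (G : SimpleGraph V) (p q : V → Prop) : Type u :=
  {s : Finset V // G.IsClique (s : Set V) ∧ (∃ v ∈ s, p v) ∧ ∃ v ∈ s, q v}

/-- The level surface for abstract sign conditions. With `p v := f v - c < 0` and
`q v := 0 < f v - c` it is `levelSurface G f c` by definition, so that the level surfaces of `f` are
indexed by finitely many pairs of sign conditions. -/
def signSurface {V : Type u} (G : SimpleGraph V) (p q : V → Prop) :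
    SimpleGraph (SignVertex G p q) where
  Adj s t := s.1 ⊂ t.1 ∨ t.1 ⊂ s.1
  symm := ⟨fun _ _ h => h.symm⟩
  loopless := ⟨fun s h => h.elim (ssubset_irrefl s.1) (ssubset_irrefl s.1)⟩

/-- Extension of a function to the level surface for abstract sign conditions. -/
noncomputable def signExtend {V : Type u} (G : SimpleGraph V) (p q : V → Prop) (g : V → ℝ) :
    SignVertex G p q → ℝ :=
  fun s => (∑ v ∈ s.1, g v) / (s.1.card : ℝ)

/-- The unit sphere of a simplex `s` in the level surface is the join of the sphere formed by the
mixed proper subsets of `s` and of the refinement of the link of `s`. -/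
theorem IsDGraph.signSurface {V : Type u} {G : SimpleGraph V} {d : ℕ} (hG : IsDGraph (d + 1) G)
    {p q : V → Prop} (hpq : ∀ v, q v ↔ ¬ p v) : IsDGraph d (signSurface G p q) := by
  classical
  obtain ⟨hV, hS⟩ := hG
  have : Finite (SignVertex G p q) := inferInstanceAs (Finite {s : Finset V // _})
  refine ⟨this, ?_⟩
  rintro ⟨s, hc, hp, hq⟩
  obtain ⟨a, has, ha⟩ := hp
  obtain ⟨b, hbs, hb⟩ := hq
  have hcard : 2 ≤ s.card :=
    Finset.one_lt_card.2 ⟨a, has, b, hbs, fun h => (hpq b).1 hb (h ▸ ha)⟩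
  set S : Set (Finset V) := {s | G.IsClique (s : Set V) ∧ (∃ v ∈ s, p v) ∧ ∃ v ∈ s, q v}
  obtain ⟨m, hm, hl⟩ := PredSphereOn.link (hS a) (s \ {a}) (s.finite_toSet.subset sdiff_subset)
    (fun v hv => hc has hv.1 fun h => hv.2 h.symm) (hc.subset sdiff_subset)
  rw [Set.ncard_sdiff_singleton_of_mem (by exact has), Set.ncard_coe_finset] at hm
  have e1 : S ∩ Iio s = mixedProperSubsets p q s := by
    ext t
    exact ⟨fun h => ⟨h.2, h.1.2⟩, fun h => ⟨⟨hc.subset h.1.le, h.2⟩, h.1⟩⟩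
  have e2 : S ∩ Ioi s = simplicesOver G
      (G.neighborSet a ∩ {v | ∀ w ∈ (s : Set V) \ {a}, G.Adj w v}) s := by
    ext t
    constructor
    · rintro ⟨⟨ht, -⟩, hst : s < t⟩
      have hadj : ∀ v ∈ t, v ∉ s → ∀ w ∈ s, G.Adj w v := fun v hv hvs w hw =>
        ht (hst.le hw) hv fun h => hvs (h ▸ hw)
      exact ⟨hst, fun v hv hvs => ⟨hadj v hv hvs a has, fun w hw => hadj v hv hvs w hw.1⟩,
        ht.subset fun v hv => hv.1⟩
    · rintro ⟨hst, htU, ht⟩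
      have hadj : ∀ v ∈ t, v ∉ s → ∀ w ∈ s, G.Adj w v := fun v hv hvs w hw => by
        by_cases hwa : w = a
        · exact hwa ▸ (htU v hv hvs).1
        · exact (htU v hv hvs).2 w ⟨hw, hwa⟩
      refine ⟨⟨fun v hv w hw hne => ?_, ⟨a, hst.le has, ha⟩, b, hst.le hbs, hb⟩, hst⟩
      by_cases hvs : v ∈ s <;> by_cases hws : w ∈ s
      · exact hc hvs hws hne
      · exact hadj w hw hws v hvs
      · exact (hadj v hv hvs w hws).symm
      · exact ht ⟨hv, hvs⟩ ⟨hw, hws⟩ hne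
  have := PredSphereOn.inter_neighborSet (S := S) (x := s)
    (e1 ▸ predSphereOn_mixedProperSubsets hpq (s.card - 2) s ⟨a, has, ha⟩ ⟨b, hbs, hb⟩ (by omega))
    (e2 ▸ hl.simplicesOver s fun v hv hvU => by
      by_cases hva : v = a
      · exact G.loopless.irrefl a (by simpa [hva] using hvU.1)
      · exact G.loopless.irrefl v (hvU.2 v ⟨hv, hva⟩))
  rw [show s.card - 2 + m = d by omega] at this
  exact IsPredSphere.of_iso this
    (isoUnitSphereInduce (comparabilityGraph (Finset V)) S ⟨s, hc, ⟨a, has, ha⟩, b, hbs, hb⟩).symm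

/-! ### Rational independence on simplices -/

/-- The values of `f` at the vertices of every simplex are rationally independent. Unlike strong
injectivity, this property passes to the extensions of `f` to level surfaces. -/
def IndependentOnSimplices {V : Type u} (G : SimpleGraph V) (f : V → ℝ) : Prop :=
  ∀ s : Finset V, G.IsClique (s : Set V) → LinearIndepOn ℚ f (s : Set V)

theorem StronglyInjective.independentOnSimplices {V : Type u} {f : V → ℝ}
    (hf : StronglyInjective f) (G : SimpleGraph V) : IndependentOnSimplices G f :=
  fun _ _ => LinearIndependent.linearIndepOn hf _

/-- The simplices of a level surface are chains of simplices of `G`. Along such a chain, every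
average involves a value of `g` that does not occur in the previous ones. -/
theorem IndependentOnSimplices.signExtend {V : Type u} {G : SimpleGraph V} {g : V → ℝ}
    (hg : IndependentOnSimplices G g) (p q : V → Prop) :
    IndependentOnSimplices (signSurface G p q) (signExtend G p q g) := by
  classical
  intro c hc
  induction hn : c.card using Nat.strong_induction_on generalizing c with
  | _ n ih =>
  obtain rfl | hne := c.eq_empty_or_nonempty
  · simp
  obtain ⟨t, htc, hmax⟩ := c.exists_max_image (fun s => s.1.card) hne
  have hlt : ∀ s ∈ c.erase t, s.1 ⊂ t.1 := fun s hs => by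
    obtain ⟨hst, hs⟩ := Finset.mem_erase.1 hs
    obtain h | h := hc hs htc hst
    · exact h
    · exact absurd (Finset.card_lt_card h) (hmax s hs).not_gt
  obtain ⟨v, hvt, hv⟩ : ∃ v ∈ t.1, ∀ s ∈ c.erase t, v ∉ s.1 := by
    obtain he | hne' := (c.erase t).eq_empty_or_nonempty
    · obtain ⟨v, hv, -⟩ := t.2.2.1
      exact ⟨v, hv, by simp [he]⟩
    · obtain ⟨r, hr, hrmax⟩ := (c.erase t).exists_max_image (fun s => s.1.card) hne'
      obtain ⟨v, hv, hvr⟩ := Finset.exists_of_ssubset (hlt r hr)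
      refine ⟨v, hv, fun s hs hvs => ?_⟩
      by_cases hsr : s = r
      · exact hvr (hsr ▸ hvs)
      · obtain h | h := hc (Finset.mem_of_mem_erase hs) (Finset.mem_of_mem_erase hr) hsr
        · exact hvr (h.le hvs)
        · exact absurd (Finset.card_lt_card h) (hrmax s hs).not_gt
  have hti : LinearIndepOn ℚ g (insert v (t.1.erase v : Set V)) := by
    rw [← Finset.coe_insert, Finset.insert_erase hvt]
    exact hg t.1 t.2.1
  have hvspan := ((linearIndepOn_insert (by simp)).1 hti).2
  set W := Submodule.span ℚ (g '' (t.1.erase v : Set V))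
  have hW : ∀ s ∈ c.erase t, DiscreteSard.signExtend G p q g s ∈ W := fun s hs => by
    have hsum : ∑ w ∈ s.1, g w ∈ W := Submodule.sum_mem _ fun w hw =>
      Submodule.subset_span ⟨w, Finset.mem_coe.2 (Finset.mem_erase.2
        ⟨fun h => hv s hs (h ▸ hw), (hlt s hs).le hw⟩), rfl⟩
    have := W.smul_mem ((s.1.card : ℚ)⁻¹) hsum
    rwa [Rat.smul_def, Rat.cast_inv, Rat.cast_natCast, mul_comm, ← div_eq_mul_inv] at this
  rw [← Finset.insert_erase htc, Finset.coe_insert, linearIndepOn_insert (by simp)]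
  refine ⟨ih _ (hn ▸ Finset.card_erase_lt_of_mem htc) _
    (hc.subset (Finset.coe_subset.2 (Finset.erase_subset t c))) rfl, fun ht => hvspan ?_⟩
  have htW : DiscreteSard.signExtend G p q g t ∈ W :=
    (Submodule.span_le.2 (by rintro _ ⟨s, hs, rfl⟩; exact hW s hs)) ht
  have hcard : (t.1.card : ℝ) ≠ 0 := by exact_mod_cast (Finset.card_pos.2 ⟨v, hvt⟩).ne'
  have h1 := W.smul_mem (t.1.card : ℚ) htW
  rw [Rat.smul_def, Rat.cast_natCast, DiscreteSard.signExtend, mul_div_cancel₀ _ hcard,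
    ← Finset.add_sum_erase _ _ hvt] at h1
  exact (W.add_mem_iff_left (Submodule.sum_mem _ fun w hw =>
    Submodule.subset_span ⟨w, Finset.mem_coe.2 hw, rfl⟩)).1 h1

/-- In a graph of positive dimension every vertex has a neighbour, and the values at two adjacent
vertices differ. -/
theorem IsDGraph.not_isConstant {V : Type u} {G : SimpleGraph V} {d : ℕ} (hG : IsDGraph (d + 1) G)
    {f : V → ℝ} (hf : IndependentOnSimplices G f) : ¬ IsConstant f := by
  classical
  rintro ⟨a, ha⟩
  obtain ⟨x, -⟩ : a ∈ range f := ha ▸ mem_singleton a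
  obtain ⟨-, -, ⟨y, hxy : G.Adj x y⟩, -⟩ := hG.2 x
  have hfa : ∀ v, f v = a := fun v => by
    have : f v ∈ range f := mem_range_self v
    rwa [ha] at this
  have hc : G.IsClique (({x, y} : Finset V) : Set V) := by
    simp [hxy]
  exact hxy.ne ((hf _ hc).injOn (by simp) (by simp) ((hfa x).trans (hfa y).symm))

/-! ### Finiteness of the set of exceptional values -/

theorem exists_finite_exceptional_sets (k : ℕ) {V : Type u} (G : SimpleGraph V) (d : ℕ)
    (hk : k ≤ d) (hG : IsDGraph d G) (f : Fin k → V → ℝ)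
    (hf : ∀ j, IndependentOnSimplices G (f j)) :
    ∃ C : Fin k → Set ℝ, (∀ j, (C j).Finite) ∧ ∀ c : Fin k → ℝ, (∀ j, c j ∉ C j) →
      Compatible k G f c ∧ IsDGraph (d - k) (iteratedLevel k G f c).2 := by
  induction k generalizing V d with
  | zero => exact ⟨fun _ => ∅, fun _ => finite_empty, fun c _ => ⟨trivial, hG⟩⟩
  | succ k ih =>
  obtain ⟨d, rfl⟩ : ∃ e, d = e + 1 := ⟨d - 1, by omega⟩
  have : Finite V := hG.1
  -- Exceptional sets for the level surface with given sign conditions; the value for pairs that do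
  -- not partition the vertices is irrelevant, because such pairs do not occur.
  have key : ∀ σ : (V → Prop) × (V → Prop), ∃ C : Fin k → Set ℝ, (∀ j, (C j).Finite) ∧
      ((∀ v, σ.2 v ↔ ¬ σ.1 v) → ∀ c : Fin k → ℝ, (∀ j, c j ∉ C j) →
        Compatible k (signSurface G σ.1 σ.2) (fun j => signExtend G σ.1 σ.2 (f j.succ)) c ∧
        IsDGraph (d - k) (iteratedLevel k (signSurface G σ.1 σ.2)
          (fun j => signExtend G σ.1 σ.2 (f j.succ)) c).2) := by
    rintro ⟨p, q⟩
    by_cases hpq : ∀ v, q v ↔ ¬ p v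
    · obtain ⟨C, hC, h⟩ := ih (signSurface G p q) d (by omega) (hG.signSurface hpq) _
        fun j => (hf j.succ).signExtend p q
      exact ⟨C, hC, fun _ => h⟩
    · exact ⟨fun _ => ∅, fun _ => finite_empty, fun h => absurd h hpq⟩
  choose C hC h using key
  refine ⟨Fin.cons (range (f 0)) fun j => ⋃ σ, C σ j, Fin.cases (finite_range _) fun j =>
    finite_iUnion fun σ => hC σ j, fun c hc => ?_⟩
  have h0 : c 0 ∉ range (f 0) := hc 0
  have hσ := h (fun v => f 0 v - c 0 < 0, fun v => 0 < f 0 v - c 0) (fun v => ?_)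
    (fun j => c j.succ) fun j hj => hc j.succ (mem_iUnion.2 ⟨_, hj⟩)
  · rw [Nat.add_sub_add_right]
    exact ⟨⟨h0, hG.not_isConstant (hf 0), hσ.1⟩, hσ.2⟩
  · have : f 0 v - c 0 ≠ 0 := fun hv => h0 ⟨v, sub_eq_zero.1 hv⟩
    exact ⟨fun h => h.not_gt, fun h => lt_of_le_of_ne (not_lt.1 h) this.symm⟩

end DiscreteSard

theorem mainTheorem3 {V : Type*} (G : SimpleGraph V) (d k : ℕ) (hk : k ≤ d)
    (hG : DiscreteSard.IsDGraph d G) (f : Fin k → V → ℝ)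
    (hf : ∀ j, DiscreteSard.StronglyInjective (f j)) :
    ∃ C : Fin k → Set ℝ, (∀ j, (C j).Finite) ∧
      ∀ c : Fin k → ℝ, (∀ j, c j ∉ C j) →
        DiscreteSard.Compatible k G f c ∧
          DiscreteSard.IsDGraph (d - k) (DiscreteSard.iteratedLevel k G f c).2 :=
  DiscreteSard.exists_finite_exceptional_sets k G d hk hG f fun j =>
    (hf j).independentOnSimplices G
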